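/- **Theorem (global convergence).** Let $n\ge 3$, let $G=(V,E)$ be an undirected simple graph on $V=\{1,\dots,n\}$ with neighbour sets $N_i$, and let $p^*=(p_1^*,\dots,p_n^*)\in\mathbb R^{2n}$ have pairwise distinct points $p_i^*\in\mathbb R^2$. Write $R(\theta)\in\mathbb R^{2\times 2}$ for the rotation matrix of angle $\theta$, and $b_{ij}(p)=(p_j-p_i)/\|p_j-p_i\|$. For unit vectors, the signed angle from $u$ to $v$ is the counter-clockwise angle in $[0,2\pi)$ from $u$ to $v$; let $\alpha_{ijk}(p)$ be the signed angle from $b_{ji}(p)$ to $b_{jk}(p)$. Assume that the target formation $(G,p^*)$ is infinitesimally signed angle rigid (ISAR): every $v\in\mathbb R^{2n}$ that satisfies, for all $i<k$ and $j$ with $(j,i),(j,k)\in E$, $$\frac{b_{ji}(p^*)^\top R(\tfrac{\pi}{2})}{\|p^*_i-p^*_j\|}(v_i-v_j)-\frac{b_{jk}(p^*)^\top R(\tfrac{\pi}{2})}{\|p^*_k-p^*_j\|}(v_k-v_j)=0$$ (i.e. every $v$ in the null space of the Jacobian of the signed angles $\alpha_{ijk}$ at $p^*$) is a linear combination of $p^*$,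 $(I_n\otimes R(\frac{\pi}{2}))p^*$, $\mathbf 1_n\otimes(1,0)^\top$ and $\mathbf 1_n\otimes(0,1)^\top$. Fix an edge $(r,s)\in E$ and let $\alpha^*_{ij}$ be the signed angle from $b_{rs}(p^*)$ to $b_{ij}(p^*)$. Consider agents with positions $p_i(t)\in\mathbb R^2$ and attitudes $\beta_i(t)\in\mathbb R$, and the closed loop $$\dot p_i=R(\beta_i)u_i^p,\qquad \dot\beta_i=u_i^a,\qquad u_i^p=-\sum_{j\in N_i}\bar R(\alpha^i_{ij})\,\eta(\beta_{ij},\alpha^*_{ij}),\qquad u_i^a=-\sum_{j\in N_i}\beta_{ij},$$ where $\beta_{ij}=\beta_i-\beta_j$, $\alpha^i_{ij}$ is the signed angle from $(1,0)^\top$ to $R(-\beta_i)b_{ij}(p)$ (the direction of edge $(i,j)$ in the body frame of agent $i$), $\eta(\beta_{ij},\alpha^*_{ij})=R\big(\tfrac{2\alpha^*_{ij}-\beta_{ij}}{2}\big)\,[0,\cos\tfrac{\beta_{ij}}{2}]^\top$ and $$\bar R(\alpha)=\begin{bmatrix}1-\cos2\alpha&-\sin2\alpha\\-\sin2\alpha&1+\cos2\alpha\end{bmatrix}.$$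 Then, for arbitrary initial positions $p(0)$ and attitudes $\beta(0)$, every solution $(p(t),\beta(t))$ of the closed loop that exists for all $t\ge 0$ and along which neighbouring agents never coincide (so that the measured angles are defined) is such that $p(t)$ converges exponentially to the similarity class $$\mathscr E(p^*)=\{c\,(I_n\otimes R(\theta))p^*+\mathbf 1_n\otimes\xi:\ c\in\mathbb R\setminus\{0\},\ \theta\in[0,2\pi),\ \xi\in\mathbb R^2\}:$$ there are $q\in\mathscr E(p^*)$, $C>0$ and $\lambda>0$, depending on the solution, with $\|p(t)-q\|\le Ce^{-\lambda t}$ for all $t\ge 0$; in particular $\operatorname{dist}(p(t),\mathscr E(p^*))\le Ce^{-\lambda t}$. -/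

import Mathlib

open scoped Matrix

noncomputable section

namespace SignedAngle

/-- The Euclidean plane. -/
abbrev Plane : Type := EuclideanSpace ℝ (Fin 2)

/-- Configurations of `n` points in the plane, i.e. `ℝ^{2n}` with its Euclidean norm. -/
abbrev Config (n : ℕ) : Type := PiLp 2 (fun _ : Fin n => Plane)

/-- A `2 × 2` matrix acting on a vector of the plane. -/
def act (M : Matrix (Fin 2) (Fin 2) ℝ) (x : Plane) : Plane :=
  WithLp.toLp 2 (M *ᵥ WithLp.ofLp x)

/-- The rotation matrix of angle `θ`. -/
def rot (θ : ℝ) : Matrix (Fin 2) (Fin 2) ℝ :=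
  !![Real.cos θ, -Real.sin θ; Real.sin θ, Real.cos θ]

/-- `x^⊥`, the vector `x` rotated by `π / 2`. -/
def perp (x : Plane) : Plane := act (rot (Real.pi / 2)) x

/-- The bearing `b_{ij} = (p_j - p_i) / ‖p_j - p_i‖` from `p_i` to `p_j`. -/
def bearing {n : ℕ} (p : Config n) (i j : Fin n) : Plane :=
  (‖p j - p i‖)⁻¹ • (p j - p i)

/-- The counter-clockwise signed angle in `[0, 2π)` from the unit vector `u` to the unit
vector `v`. -/
def signedAngle (u v : Plane) : ℝ :=
  if 0 ≤ inner ℝ v (perp u) then Real.arccos (inner ℝ v u)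
  else 2 * Real.pi - Real.arccos (inner ℝ v u)

/-- The index set of all signed angles of a graph: `(i, j, k)` stands for the angle
from `b_{ji}` to `b_{jk}`. -/
def angleIndexSet {n : ℕ} (G : SimpleGraph (Fin n)) : Set (Fin n × Fin n × Fin n) :=
  {t | G.Adj t.2.1 t.1 ∧ G.Adj t.2.1 t.2.2 ∧ t.1 < t.2.2}

/-- The row vector `b_{ji}ᵀ R(π/2) / ‖p_i - p_j‖`; its negative is the differential of the
direction angle of `b_{ji}` with respect to `p_i - p_j`. -/
def rigidityBlock {n : ℕ} (p : Config n) (j i : Fin n) : Fin 2 → ℝ :=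
  (‖p i - p j‖)⁻¹ • (WithLp.ofLp (bearing p j i) ᵥ* rot (Real.pi / 2))

/-- The signed angle rigidity matrix (the Jacobian of the signed angles `α_{ijk}` with respect
to the configuration): rows are indexed by the signed angles, columns by the coordinates of the
vertices. -/
def rigidityMatrix {n : ℕ} (G : SimpleGraph (Fin n)) (p : Config n) :
    Matrix (angleIndexSet G) (Fin n × Fin 2) ℝ :=
  Matrix.of fun t x =>
    let i := t.1.1
    let j := t.1.2.1
    let k := t.1.2.2
    rigidityBlock p j i x.2 * ((if x.1 = i then 1 else 0) - (if x.1 = j then 1 else 0))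
      - rigidityBlock p j k x.2 * ((if x.1 = k then 1 else 0) - (if x.1 = j then 1 else 0))

/-- A configuration (or a motion) as a column vector of `2n` real coordinates. -/
def coords {n : ℕ} (v : Config n) : Fin n × Fin 2 → ℝ := fun x => v x.1 x.2

/-- Infinitesimal signed angle motions: the null space of the rigidity matrix. -/
def IsInfinitesimalMotion {n : ℕ} (G : SimpleGraph (Fin n)) (p v : Config n) : Prop :=
  rigidityMatrix G p *ᵥ coords v = 0

/-- The trivial motions: uniform scaling, uniform rotation and uniform translations. -/
def trivialMotions {n : ℕ} (p : Config n) : Submodule ℝ (Config n) :=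
  Submodule.span ℝ
    {p, WithLp.toLp 2 (fun i => perp (p i)),
      WithLp.toLp 2 (fun _ => !₂[(1 : ℝ), 0]), WithLp.toLp 2 (fun _ => !₂[(0 : ℝ), 1])}

/-- `(G, p)` is a framework: distinct vertices are placed at distinct points. -/
def IsFramework {n : ℕ} (_G : SimpleGraph (Fin n)) (p : Config n) : Prop :=
  ∀ i j : Fin n, i ≠ j → p i ≠ p j

/-- The framework `(G, p)` is infinitesimally signed angle rigid: all of its infinitesimal
signed angle motions are trivial. -/
def IsISAR {n : ℕ} (G : SimpleGraph (Fin n)) (p : Config n) : Prop :=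
  IsFramework G p ∧ ∀ v : Config n, IsInfinitesimalMotion G p v → v ∈ trivialMotions p

/-- The configurations of the same shape as `p`. -/
def similarityClass {n : ℕ} (p : Config n) : Set (Config n) :=
  {q | ∃ θ ∈ Set.Ico 0 (2 * Real.pi), ∃ c : ℝ, c ≠ 0 ∧ ∃ ξ : Plane,
    ∀ i, q i = c • act (rot θ) (p i) + ξ}

/-- The angle `α^*_{ij}` from the common edge `(r, s)` to the edge `(i, j)` in the target. -/
def targetAngle {n : ℕ} (pstar : Config n) (r s i j : Fin n) : ℝ :=
  signedAngle (bearing pstar r s) (bearing pstar i j)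

/-- The measured angle `α^i_{ij}`: the signed angle from the `x`-axis to the edge `(i, j)` in the
body frame of agent `i`. A vector with body coordinates `x` has global coordinates `R(β_i) x`. -/
def measuredAngle {n : ℕ} (p : Config n) (β : Fin n → ℝ) (i j : Fin n) : ℝ :=
  signedAngle !₂[(1 : ℝ), 0] (act (rot (-β i)) (bearing p i j))

/-- The matrix `R̄(α)` of the controller. -/
def Rbar (α : ℝ) : Matrix (Fin 2) (Fin 2) ℝ :=
  !![1 - Real.cos (2 * α), -Real.sin (2 * α); -Real.sin (2 * α), 1 + Real.cos (2 * α)]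

/-- The vector `η(β_{ij}, α^*_{ij})` of the controller. -/
def eta (βij αstar : ℝ) : Plane :=
  act (rot ((2 * αstar - βij) / 2)) !₂[0, Real.cos (βij / 2)]

/-- The position control input `u^p_i`, in the body frame of agent `i`. -/
def positionInput {n : ℕ} (G : SimpleGraph (Fin n)) [DecidableRel G.Adj] (pstar : Config n)
    (r s : Fin n) (p : Config n) (β : Fin n → ℝ) (i : Fin n) : Plane :=
  -∑ j ∈ G.neighborFinset i,
    act (Rbar (measuredAngle p β i j)) (eta (β i - β j) (targetAngle pstar r s i j))

/-- The attitude control input `u^a_i`. -/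
def attitudeInput {n : ℕ} (G : SimpleGraph (Fin n)) [DecidableRel G.Adj]
    (β : Fin n → ℝ) (i : Fin n) : ℝ :=
  -∑ j ∈ G.neighborFinset i, (β i - β j)

/-- The agent dynamics on `[0, ∞)`: `ṗ_i = R(β_i) u^p_i` and `β̇_i = u^a_i`. -/
def FollowsDynamics {n : ℕ} (p : ℝ → Config n) (β : ℝ → Fin n → ℝ)
    (up : ℝ → Fin n → Plane) (ua : ℝ → Fin n → ℝ) : Prop :=
  ∀ t : ℝ, 0 ≤ t → ∀ i : Fin n,
    HasDerivWithinAt (fun τ => p τ i) (act (rot (β t i)) (up t i)) (Set.Ici 0) t ∧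
    HasDerivWithinAt (fun τ => β τ i) (ua t i) (Set.Ici 0) t

end SignedAngle

end

noncomputable section

namespace SignedAngle

/-! The attitudes obey the Laplacian flow of a connected graph, so they converge exponentially to
their mean `b` (`attitude_consensus`); connectedness itself follows from rigidity. In global
coordinates (`rot_Rbar_eta`) each edge force is the projection, normal to the current bearing, of
the sum of two copies of the target bearing, rotated according to `β i` and `β j`. These forces are
antisymmetric and orthogonal to their edges, so centroid and size are conserved and the centred
configuration `w` stays on a sphere of radius `S`.

Let `q` be the centred copy of the target of size `S`, rotated as the limit attitude `b` dictates.
Up to an exponentially small error each force is twice the normal projection of the bearing of `q`,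
which pushes `w` towards `q` (`bearing_drive`). Rigidity bounds the total push from below by a
multiple of `S ^ 4 - ⟪w, q⟫ ^ 2` (`exists_bearing_coercive`). Hence `x = 1 - ⟪w, q⟫ / S ^ 2`
satisfies `x' ≤ -k x (2 - x) + C exp (-λ t)`, and `logistic_dichotomy` sends `x` exponentially to
`0` or `2`, that is, `w` to `q` or `-q`. Both limits have the target shape, since the similarity
class admits negative factors. -/

/-! ### Coordinates and rotations of the plane -/

theorem act_zero (M : Matrix (Fin 2) (Fin 2) ℝ) (x : Plane) :
    act M x 0 = M 0 0 * x 0 + M 0 1 * x 1 := by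
  simp [act]

theorem act_one (M : Matrix (Fin 2) (Fin 2) ℝ) (x : Plane) :
    act M x 1 = M 1 0 * x 0 + M 1 1 * x 1 := by
  simp [act]

theorem perp_zero (x : Plane) : perp x 0 = -x 1 := by simp [perp, act_zero, rot]

theorem perp_one (x : Plane) : perp x 1 = x 0 := by simp [perp, act_one, rot]

theorem inner_plane (x y : Plane) : inner ℝ x y = x 0 * y 0 + x 1 * y 1 := by
  simp [PiLp.inner_apply, Fin.sum_univ_two, mul_comm]

theorem norm_sq_plane (x : Plane) : ‖x‖ ^ 2 = x 0 ^ 2 + x 1 ^ 2 := by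
  rw [← real_inner_self_eq_norm_sq, inner_plane]; ring

theorem plane_ext {x y : Plane} (h0 : x 0 = y 0) (h1 : x 1 = y 1) : x = y := by
  ext i; fin_cases i <;> assumption

theorem rot_zero_zero (θ : ℝ) : rot θ 0 0 = Real.cos θ := rfl
theorem rot_zero_one (θ : ℝ) : rot θ 0 1 = -Real.sin θ := rfl
theorem rot_one_zero (θ : ℝ) : rot θ 1 0 = Real.sin θ := rfl
theorem rot_one_one (θ : ℝ) : rot θ 1 1 = Real.cos θ := rfl

theorem rot_act_zero (θ : ℝ) (x : Plane) :
    act (rot θ) x 0 = Real.cos θ * x 0 - Real.sin θ * x 1 := by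
  rw [act_zero, rot_zero_zero, rot_zero_one]; ring

theorem rot_act_one (θ : ℝ) (x : Plane) :
    act (rot θ) x 1 = Real.sin θ * x 0 + Real.cos θ * x 1 := by
  rw [act_one, rot_one_zero, rot_one_one]

theorem act_add (M : Matrix (Fin 2) (Fin 2) ℝ) (x y : Plane) :
    act M (x + y) = act M x + act M y := by
  simp only [act, WithLp.ofLp_add, Matrix.mulVec_add, WithLp.toLp_add]

theorem act_smul (M : Matrix (Fin 2) (Fin 2) ℝ) (c : ℝ) (x : Plane) :
    act M (c • x) = c • act M x := by
  simp only [act, WithLp.ofLp_smul, Matrix.mulVec_smul, WithLp.toLp_smul]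

/-- A `2 × 2` matrix as a linear map of the plane. -/
def actHom (M : Matrix (Fin 2) (Fin 2) ℝ) : Plane →ₗ[ℝ] Plane where
  toFun := act M
  map_add' := act_add M
  map_smul' := act_smul M

theorem act_sub (M : Matrix (Fin 2) (Fin 2) ℝ) (x y : Plane) :
    act M (x - y) = act M x - act M y := map_sub (actHom M) x y

theorem act_neg (M : Matrix (Fin 2) (Fin 2) ℝ) (x : Plane) :
    act M (-x) = -act M x := map_neg (actHom M) x

theorem act_sum {ι : Type*} (M : Matrix (Fin 2) (Fin 2) ℝ) (s : Finset ι) (f : ι → Plane) :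
    act M (∑ i ∈ s, f i) = ∑ i ∈ s, act M (f i) := map_sum (actHom M) f s

theorem rot_rot (a b : ℝ) (x : Plane) : act (rot a) (act (rot b) x) = act (rot (a + b)) x := by
  apply plane_ext <;> simp only [rot_act_zero, rot_act_one, Real.cos_add, Real.sin_add] <;> ring

theorem rot_zero_act (x : Plane) : act (rot 0) x = x := by
  apply plane_ext <;> simp [rot_act_zero, rot_act_one]

theorem inner_rot (a : ℝ) (x y : Plane) :
    inner ℝ (act (rot a) x) (act (rot a) y) = inner ℝ x y := by
  simp only [inner_plane, rot_act_zero, rot_act_one]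
  linear_combination (x 0 * y 0 + x 1 * y 1) * Real.sin_sq_add_cos_sq a

theorem norm_rot (a : ℝ) (x : Plane) : ‖act (rot a) x‖ = ‖x‖ := by
  rw [← sq_eq_sq₀ (norm_nonneg _) (norm_nonneg _), ← real_inner_self_eq_norm_sq, inner_rot,
    real_inner_self_eq_norm_sq]

theorem norm_perp (x : Plane) : ‖perp x‖ = ‖x‖ := norm_rot _ x

theorem perp_rot (a : ℝ) (x : Plane) : perp (act (rot a) x) = act (rot a) (perp x) := by
  rw [perp, perp, rot_rot, rot_rot, add_comm]

theorem perp_sub (x y : Plane) : perp (x - y) = perp x - perp y := act_sub _ x y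

theorem perp_smul (c : ℝ) (x : Plane) : perp (c • x) = c • perp x := act_smul _ c x

theorem perp_neg (x : Plane) : perp (-x) = -perp x := act_neg _ x

theorem inner_perp_self (x : Plane) : inner ℝ (perp x) x = 0 := by
  simp only [inner_plane, perp_zero, perp_one]; ring

theorem inner_perp_swap (x y : Plane) : inner ℝ (perp x) y = -inner ℝ x (perp y) := by
  simp only [inner_plane, perp_zero, perp_one]; ring

/-- A chord is no longer than its arc. This turns attitude errors into force errors. -/
theorem norm_rot_sub_rot_le (a b : ℝ) (x : Plane) :
    ‖act (rot a) x - act (rot b) x‖ ≤ |a - b| * ‖x‖ := by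
  have h : ‖act (rot a) x - act (rot b) x‖ ^ 2 = 2 * (1 - Real.cos (a - b)) * ‖x‖ ^ 2 := by
    rw [norm_sq_plane, norm_sq_plane, Real.cos_sub]
    simp only [PiLp.sub_apply, rot_act_zero, rot_act_one]
    linear_combination (x 0 ^ 2 + x 1 ^ 2) *
      (Real.sin_sq_add_cos_sq a + Real.sin_sq_add_cos_sq b)
  refine abs_le_of_sq_le_sq' ?_ (by positivity) |>.2
  rw [h, mul_pow, sq_abs]
  have := Real.one_sub_sq_div_two_le_cos (x := a - b)
  gcongr
  linarith

/-! ### Signed angles, bearings and the controller in global coordinates -/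

theorem cos_sin_signedAngle {u v : Plane} (hu : ‖u‖ = 1) (hv : ‖v‖ = 1) :
    Real.cos (signedAngle u v) = inner ℝ v u ∧
      Real.sin (signedAngle u v) = inner ℝ v (perp u) := by
  have hu2 := norm_sq_plane u
  have hv2 := norm_sq_plane v
  rw [hu] at hu2
  rw [hv] at hv2
  have hsq : inner ℝ v u ^ 2 + inner ℝ v (perp u) ^ 2 = 1 := by
    simp only [inner_plane, perp_zero, perp_one]
    linear_combination -(v 0 ^ 2 + v 1 ^ 2) * hu2 - hv2
  have h1 : -1 ≤ inner ℝ v u := by nlinarith [sq_nonneg (inner ℝ v (perp u))]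
  have h2 : inner ℝ v u ≤ 1 := by nlinarith [sq_nonneg (inner ℝ v (perp u))]
  have h3 : 1 - inner ℝ v u ^ 2 = inner ℝ v (perp u) ^ 2 := by linarith
  unfold signedAngle
  split_ifs with h
  · rw [Real.cos_arccos h1 h2, Real.sin_arccos, h3, Real.sqrt_sq h]
    exact ⟨rfl, rfl⟩
  · rw [Real.cos_two_pi_sub, Real.sin_two_pi_sub, Real.cos_arccos h1 h2, Real.sin_arccos, h3,
      Real.sqrt_sq_eq_abs, abs_of_neg (not_le.mp h), neg_neg]
    exact ⟨rfl, rfl⟩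

theorem rot_signedAngle {u v : Plane} (hu : ‖u‖ = 1) (hv : ‖v‖ = 1) :
    act (rot (signedAngle u v)) u = v := by
  obtain ⟨hc, hs⟩ := cos_sin_signedAngle hu hv
  have hu2 := norm_sq_plane u
  rw [hu] at hu2
  apply plane_ext <;> simp only [rot_act_zero, rot_act_one, hc, hs, inner_plane, perp_zero, perp_one]
  · linear_combination -v 0 * hu2
  · linear_combination -v 1 * hu2

theorem norm_bearing {n : ℕ} {p : Config n} {i j : Fin n} (h : p i ≠ p j) :
    ‖bearing p i j‖ = 1 := by
  have : ‖p j - p i‖ ≠ 0 := norm_ne_zero_iff.mpr (sub_ne_zero.mpr h.symm)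
  simp [bearing, norm_smul, this]

theorem bearing_swap {n : ℕ} (p : Config n) (i j : Fin n) : bearing p j i = -bearing p i j := by
  rw [bearing, bearing, ← neg_sub (p j) (p i), norm_neg, smul_neg]

/-- The orthogonal projection of `f` onto the line perpendicular to the unit vector `b`. -/
def normalPart (b f : Plane) : Plane := inner ℝ (perp b) f • perp b

theorem normalPart_neg (b f : Plane) : normalPart (-b) f = normalPart b f := by
  simp [normalPart, perp_neg]

theorem normalPart_neg_right (b f : Plane) : normalPart b (-f) = -normalPart b f := by
  simp [normalPart]

theorem rot_normalPart (a : ℝ) (b f : Plane) :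
    act (rot a) (normalPart b f) = normalPart (act (rot a) b) (act (rot a) f) := by
  rw [normalPart, normalPart, perp_rot, inner_rot, act_smul]

/-- `Rbar α` is `2 (I - b bᵀ)` written with double angles. -/
theorem Rbar_act {b : Plane} {α : ℝ} (h : act (rot α) !₂[(1 : ℝ), 0] = b) (f : Plane) :
    act (Rbar α) f = (2 : ℝ) • normalPart b f := by
  subst h
  apply plane_ext <;>
    simp [act_zero, act_one, Rbar, rot, normalPart, perp_zero, perp_one, inner_plane,
      Real.cos_two_mul, Real.sin_two_mul]
  · linear_combination -2 * f 0 * Real.sin_sq_add_cos_sq α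
  · ring

theorem rot_measuredAngle {n : ℕ} {p : Config n} {i j : Fin n} (h : p i ≠ p j) (β : Fin n → ℝ) :
    act (rot (measuredAngle p β i j)) !₂[(1 : ℝ), 0] = act (rot (-β i)) (bearing p i j) := by
  apply rot_signedAngle
  · rw [← sq_eq_sq₀ (norm_nonneg _) zero_le_one, norm_sq_plane]; simp
  · rw [norm_rot, norm_bearing h]

/-- Sum-to-product formula; it explains the half angles and the factor `cos (β_ij / 2)` in `eta`. -/
theorem rot_add_rot (a b : ℝ) (x : Plane) :
    act (rot a) x + act (rot b) x =
      (2 : ℝ) • act (rot ((a + b) / 2)) (Real.cos ((a - b) / 2) • x) := by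
  have ha : a = (a + b) / 2 + (a - b) / 2 := by ring
  have hb : b = (a + b) / 2 - (a - b) / 2 := by ring
  apply plane_ext
  · simp only [PiLp.add_apply, PiLp.smul_apply, smul_eq_mul, rot_act_zero]
    rw [congrArg Real.cos ha, congrArg Real.cos hb, congrArg Real.sin ha, congrArg Real.sin hb,
      Real.cos_add, Real.cos_sub, Real.sin_add, Real.sin_sub]
    ring
  · simp only [PiLp.add_apply, PiLp.smul_apply, smul_eq_mul, rot_act_one]
    rw [congrArg Real.cos ha, congrArg Real.cos hb, congrArg Real.sin ha, congrArg Real.sin hb,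
      Real.cos_add, Real.cos_sub, Real.sin_add, Real.sin_sub]
    ring

theorem exists_rot_eq {u : Plane} (hu : ‖u‖ = 1) : ∃ θ : ℝ, act (rot θ) !₂[(1 : ℝ), 0] = u :=
  ⟨_, rot_signedAngle (by rw [← sq_eq_sq₀ (norm_nonneg _) zero_le_one, norm_sq_plane]; simp) hu⟩

/-- The term of the controller that belongs to the edge `(i, j)`, in global coordinates. -/
theorem rot_Rbar_eta {n : ℕ} {p pstar : Config n} {i j r s : Fin n} {θ : ℝ} (hp : p i ≠ p j)
    (hij : pstar i ≠ pstar j) (hrs : pstar r ≠ pstar s)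
    (hθ : act (rot θ) !₂[(1 : ℝ), 0] = bearing pstar r s) (β : Fin n → ℝ) :
    act (rot (β i)) (act (Rbar (measuredAngle p β i j))
        (eta (β i - β j) (targetAngle pstar r s i j))) =
      normalPart (bearing p i j)
        (act (rot (β i - θ + Real.pi / 2)) (bearing pstar i j) +
          act (rot (β j - θ + Real.pi / 2)) (bearing pstar i j)) := by
  have h1 : bearing pstar i j = act (rot (targetAngle pstar r s i j + θ)) !₂[(1 : ℝ), 0] := by
    rw [← rot_rot, hθ]
    exact (rot_signedAngle (norm_bearing hrs) (norm_bearing hij)).symm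
  have h2 : (!₂[0, Real.cos ((β i - β j) / 2)] : Plane) =
      Real.cos ((β i - β j) / 2) • act (rot (Real.pi / 2)) !₂[(1 : ℝ), 0] := by
    apply plane_ext <;> simp [rot_act_zero, rot_act_one]
  rw [Rbar_act (rot_measuredAngle hp β), act_smul, rot_normalPart, rot_rot, add_neg_cancel,
    rot_zero_act, h1, rot_rot, rot_rot, rot_add_rot, eta, h2, act_smul, act_smul, act_smul,
    rot_rot, rot_rot]
  set T := targetAngle pstar r s i j
  have e1 : β i - θ + Real.pi / 2 + (T + θ) - (β j - θ + Real.pi / 2 + (T + θ)) = β i - β j := by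
    ring
  have e2 : (β i - θ + Real.pi / 2 + (T + θ) + (β j - θ + Real.pi / 2 + (T + θ))) / 2 =
      β i + ((2 * T - (β i - β j)) / 2 + Real.pi / 2) := by ring
  rw [e1, e2]
  simp only [normalPart, inner_smul_right, smul_smul, mul_assoc, add_assoc]

/-! ### Scalar differential inequalities on a half-line -/

theorem antitoneOn_Ici_of_hasDerivWithinAt {f f' : ℝ → ℝ} {a t₀ : ℝ} (ha : a ≤ t₀)
    (hf : ∀ t, a ≤ t → HasDerivWithinAt f (f' t) (Set.Ici a) t)
    (hf' : ∀ t, t₀ ≤ t → f' t ≤ 0) : AntitoneOn f (Set.Ici t₀) := by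
  refine antitoneOn_of_hasDerivWithinAt_nonpos (f' := f') (convex_Ici t₀) ?_ ?_ ?_
  · intro t ht
    exact ((hf t (ha.trans ht)).continuousWithinAt).mono (Set.Ici_subset_Ici.mpr ha)
  · intro t ht
    rw [interior_Ici] at ht ⊢
    exact (hf t (ha.trans (le_of_lt ht))).mono
      (fun y hy => ha.trans (le_of_lt hy))
  · intro t ht
    rw [interior_Ici] at ht
    exact hf' t (le_of_lt ht)

theorem eq_of_hasDerivWithinAt_zero {f : ℝ → ℝ}
    (hf : ∀ t, 0 ≤ t → HasDerivWithinAt f 0 (Set.Ici 0) t) {t : ℝ} (ht : 0 ≤ t) : f t = f 0 := by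
  apply le_antisymm
  · exact antitoneOn_Ici_of_hasDerivWithinAt le_rfl hf (fun _ _ => le_rfl)
      Set.self_mem_Ici ht ht
  · have := antitoneOn_Ici_of_hasDerivWithinAt (f := fun t => -f t) le_rfl
      (fun t ht => (hf t ht).neg) (fun _ _ => by simp) Set.self_mem_Ici ht ht
    linarith

theorem hasDerivWithinAt_exp_mul (k t : ℝ) (s : Set ℝ) :
    HasDerivWithinAt (fun t => Real.exp (k * t)) (k * Real.exp (k * t)) s t := by
  have h : HasDerivAt (fun t : ℝ => k * t) k t := by
    simpa using (hasDerivAt_id t).const_mul k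
  simpa [mul_comm] using h.exp.hasDerivWithinAt

/-- Grönwall's inequality for a linear decay rate. -/
theorem le_exp_of_deriv_le {f f' : ℝ → ℝ} {k t₀ : ℝ} (h0 : 0 ≤ t₀)
    (hf : ∀ t, 0 ≤ t → HasDerivWithinAt f (f' t) (Set.Ici 0) t)
    (hf' : ∀ t, t₀ ≤ t → f' t ≤ -k * f t) {t : ℝ} (ht : t₀ ≤ t) :
    f t ≤ f t₀ * Real.exp (k * t₀) * Real.exp (-k * t) := by
  have hg := antitoneOn_Ici_of_hasDerivWithinAt (f := fun t => f t * Real.exp (k * t)) h0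
    (fun t ht => (hf t ht).mul (hasDerivWithinAt_exp_mul k t _)) (fun t ht => by
      have h1 := hf' t ht
      have h2 := Real.exp_pos (k * t)
      nlinarith) Set.self_mem_Ici ht ht
  have h3 : Real.exp (k * t) * Real.exp (-k * t) = 1 := by
    rw [← Real.exp_add]; simp
  calc f t = f t * Real.exp (k * t) * Real.exp (-k * t) := by rw [mul_assoc, h3, mul_one]
    _ ≤ _ := by gcongr

/-- A function on `[0, ∞)` with values in `[0, 2]` that decreases at least as fast as the logistic
equation prescribes, up to an exponentially small error, tends exponentially to `0` or to `2`. -/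
theorem logistic_dichotomy {x x' : ℝ → ℝ} {k C lam : ℝ} (hk : 0 < k) (hC : 0 ≤ C) (hlam : 0 < lam)
    (hx : ∀ t, 0 ≤ t → HasDerivWithinAt x (x' t) (Set.Ici 0) t)
    (hx0 : ∀ t, 0 ≤ t → 0 ≤ x t) (hx2 : ∀ t, 0 ≤ t → x t ≤ 2)
    (hx' : ∀ t, 0 ≤ t → x' t ≤ -k * (x t * (2 - x t)) + C * Real.exp (-lam * t)) :
    ∃ K ν : ℝ, 0 < K ∧ 0 < ν ∧ ((∀ t, 0 ≤ t → x t ≤ K * Real.exp (-ν * t)) ∨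
      ∀ t, 0 ≤ t → 2 - x t ≤ K * Real.exp (-ν * t)) := by
  by_cases hcase : ∀ t, 0 ≤ t → 2 - x t ≤ ((C + 1) / lam) * Real.exp (-lam * t)
  · exact ⟨(C + 1) / lam, lam, by positivity, hlam, Or.inr hcase⟩
  push Not at hcase
  obtain ⟨t₀, ht₀, hlt⟩ := hcase
  -- With this `A`, the derivative of `A exp (-lam t)` absorbs the error term, so `x + A exp (-lam
  -- t)` decreases and a gap below `2` at `t₀` persists. The `+ 1` keeps `A` positive when `C = 0`.
  set A := (C + 1) / lam with hA
  have hAlam : A * lam = C + 1 := by rw [hA]; field_simp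
  set ε := 2 - x t₀ - A * Real.exp (-lam * t₀) with hε
  have hεpos : 0 < ε := by linarith
  have hmono := antitoneOn_Ici_of_hasDerivWithinAt
    (f := fun t => x t + A * Real.exp (-lam * t)) ht₀
    (fun t ht => (hx t ht).add ((hasDerivWithinAt_exp_mul (-lam) t _).const_mul A))
    (fun t ht => by
      have h1 := hx' t (ht₀.trans ht)
      have h2 := Real.exp_pos (-lam * t)
      have h3 : 0 ≤ k * (x t * (2 - x t)) := mul_nonneg hk.le (mul_nonneg (hx0 t (ht₀.trans ht))
        (by linarith [hx2 t (ht₀.trans ht)]))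
      have h4 : A * (-lam * Real.exp (-lam * t)) = -(C + 1) * Real.exp (-lam * t) := by
        rw [← hAlam]; ring
      rw [h4]
      nlinarith)
  have hgap : ∀ t, t₀ ≤ t → ε ≤ 2 - x t := fun t ht => by
    have h1 := hmono Set.self_mem_Ici ht ht
    have h2 : 0 < A * Real.exp (-lam * t) := by positivity
    simp only at h1
    linarith
  -- The gap makes the logistic term at least `k ε x`; staying below `lam` avoids resonance with the
  -- error.
  set ν := min (k * ε) (lam / 2) with hν
  have hνpos : 0 < ν := by positivity
  have hν1 : ν ≤ k * ε := min_le_left _ _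
  have hν2 : 0 < lam - ν := by linarith [min_le_right (k * ε) (lam / 2)]
  -- Chosen so that `x + B exp (-lam t)` satisfies a homogeneous inequality with rate `ν`.
  set B := C / (lam - ν) with hB
  have hBeq : B * lam - C = ν * B := by
    have : B * (lam - ν) = C := by rw [hB]; field_simp
    linarith
  have hB0 : 0 ≤ B := by positivity
  have hdecay : ∀ t, t₀ ≤ t → x t + B * Real.exp (-lam * t) ≤
      (x t₀ + B * Real.exp (-lam * t₀)) * Real.exp (ν * t₀) * Real.exp (-ν * t) := fun t ht => by
    refine le_exp_of_deriv_le (f := fun t => x t + B * Real.exp (-lam * t)) ht₀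
      (fun t ht => (hx t ht).add ((hasDerivWithinAt_exp_mul (-lam) t _).const_mul B))
      (fun t ht => ?_) ht
    have h1 := hx' t (ht₀.trans ht)
    have h2 : ν * x t ≤ k * (x t * (2 - x t)) := by
      have h3 := hx0 t (ht₀.trans ht)
      calc ν * x t ≤ k * ε * x t := by gcongr
        _ = k * (x t * ε) := by ring
        _ ≤ _ := by gcongr; exact hgap t ht
    have h4 : B * (-lam * Real.exp (-lam * t)) =
        -(C + ν * B) * Real.exp (-lam * t) := by
      rw [← hBeq]; ring
    rw [h4]
    linarith
  have hx00 := hx0 t₀ ht₀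
  set M := (x t₀ + B * Real.exp (-lam * t₀)) * Real.exp (ν * t₀) with hM
  have hM0 : 0 ≤ M := by positivity
  -- The second summand covers `[0, t₀]`, where only `x ≤ 2` is available.
  refine ⟨M + 2 * Real.exp (ν * t₀), ν, by positivity, hνpos, Or.inl fun t ht => ?_⟩
  rcases le_total t₀ t with h | h
  · have h1 := hdecay t h
    have h2 : 0 ≤ B * Real.exp (-lam * t) := by positivity
    have h3 : 0 ≤ 2 * Real.exp (ν * t₀) * Real.exp (-ν * t) := by positivity
    linarith
  · have h1 : 1 ≤ Real.exp (ν * t₀) * Real.exp (-ν * t) := by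
      rw [← Real.exp_add]
      exact Real.one_le_exp (by nlinarith)
    have h2 : 0 ≤ M * Real.exp (-ν * t) := by positivity
    linarith [hx2 t ht]

/-! ### Quantitative consequences of rigidity -/

/-- `B` factors through the range of `A`; the factor extends to all of `F` and is bounded because
`F` is finite-dimensional. This upgrades kernel statements to the Poincaré and coercivity
inequalities. -/
theorem exists_norm_le_of_ker_le {E F H : Type*} [AddCommGroup E] [Module ℝ E]
    [NormedAddCommGroup F] [NormedSpace ℝ F] [FiniteDimensional ℝ F]
    [NormedAddCommGroup H] [NormedSpace ℝ H] (A : E →ₗ[ℝ] F) (B : E →ₗ[ℝ] H)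
    (h : ∀ v, A v = 0 → B v = 0) : ∃ c : ℝ, 0 < c ∧ ∀ v, ‖B v‖ ≤ c * ‖A v‖ := by
  obtain ⟨g, hg⟩ : ∃ g : F →ₗ[ℝ] H, g ∘ₗ A = B := by
    have hle : LinearMap.ker A ≤ LinearMap.ker B := fun v hv => h v hv
    obtain ⟨g, hg⟩ := LinearMap.exists_extend
      ((LinearMap.ker A).liftQ B hle ∘ₗ A.quotKerEquivRange.symm.toLinearMap)
    refine ⟨g, LinearMap.ext fun v => ?_⟩
    have h1 := LinearMap.congr_fun hg ⟨A v, LinearMap.mem_range_self A v⟩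
    have h2 : A.quotKerEquivRange.symm ⟨A v, LinearMap.mem_range_self A v⟩ =
        (LinearMap.ker A).mkQ v := by
      rw [LinearEquiv.symm_apply_eq]; rfl
    simpa [h2] using h1
  obtain ⟨c, hc, hle⟩ := (LinearMap.toContinuousLinearMap g).bound
  exact ⟨c, hc, fun v => by simpa [← hg] using hle (A v)⟩

theorem rigidityMatrix_mulVec {n : ℕ} (G : SimpleGraph (Fin n)) (p v : Config n)
    (t : angleIndexSet G) :
    (rigidityMatrix G p *ᵥ coords v) t =
      (rigidityBlock p t.1.2.1 t.1.1 ⬝ᵥ WithLp.ofLp (v t.1.1 - v t.1.2.1)) -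
        rigidityBlock p t.1.2.1 t.1.2.2 ⬝ᵥ WithLp.ofLp (v t.1.2.2 - v t.1.2.1) := by
  have key : ∀ (a : Fin 2 → ℝ) (i : Fin n),
      ∑ x : Fin n × Fin 2, a x.2 * (if x.1 = i then 1 else 0) * coords v x =
        a ⬝ᵥ WithLp.ofLp (v i) := fun a i => by
    rw [Fintype.sum_prod_type, Finset.sum_eq_single i]
    · simp [dotProduct, coords]
    · intro j _ hj; simp [hj]
    · simp
  simp only [Matrix.mulVec, rigidityMatrix, Matrix.of_apply]
  rw [dotProduct]
  simp only [mul_sub, sub_mul, Finset.sum_sub_distrib, key, WithLp.ofLp_sub, dotProduct_sub]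

theorem rigidityBlock_dotProduct {n : ℕ} (p : Config n) (j i : Fin n) (x : Plane) :
    rigidityBlock p j i ⬝ᵥ WithLp.ofLp x =
      -((‖p i - p j‖)⁻¹ ^ 2 * inner ℝ x (perp (p i - p j))) := by
  rw [inner_plane, perp_zero, perp_one]
  simp [rigidityBlock, bearing, rot, dotProduct, Fin.sum_univ_two, Matrix.vecHead, Matrix.vecTail]
  ring

theorem isInfinitesimalMotion_of_inner_eq_zero {n : ℕ} {G : SimpleGraph (Fin n)} {p v : Config n}
    (h : ∀ i j, G.Adj i j → inner ℝ (v i - v j) (perp (p i - p j)) = 0) :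
    IsInfinitesimalMotion G p v := by
  funext t
  obtain ⟨⟨i, j, k⟩, hji, hjk, -⟩ := t
  rw [rigidityMatrix_mulVec, rigidityBlock_dotProduct, rigidityBlock_dotProduct]
  simp only
  rw [h i j hji.symm, h k j hjk.symm]
  simp

theorem mem_trivialMotions {n : ℕ} {p v : Config n} (h : v ∈ trivialMotions p) :
    ∃ (a b : ℝ) (ξ : Plane), ∀ i, v i = a • p i + b • perp (p i) + ξ := by
  rw [trivialMotions, Submodule.mem_span_insert] at h
  obtain ⟨a, z, hz, rfl⟩ := h
  rw [Submodule.mem_span_insert] at hz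
  obtain ⟨b, z, hz, rfl⟩ := hz
  rw [Submodule.mem_span_insert] at hz
  obtain ⟨c, z, hz, rfl⟩ := hz
  rw [Submodule.mem_span_singleton] at hz
  obtain ⟨d, rfl⟩ := hz
  refine ⟨a, b, !₂[c, d], fun i => plane_ext ?_ ?_⟩ <;> simp [add_assoc]

/-- In an infinitesimally signed angle rigid framework the bearings determine the configuration up
to scaling and translation. -/
theorem IsISAR.exists_eq_smul_add {n : ℕ} {G : SimpleGraph (Fin n)} {p : Config n}
    (hp : IsISAR G p) {r s : Fin n} (hrs : G.Adj r s) {v : Config n}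
    (h : ∀ i j, G.Adj i j → inner ℝ (v i - v j) (perp (p i - p j)) = 0) :
    ∃ (a : ℝ) (ξ : Plane), ∀ i, v i = a • p i + ξ := by
  obtain ⟨a, b, ξ, hv⟩ :=
    mem_trivialMotions (hp.2 v (isInfinitesimalMotion_of_inner_eq_zero h))
  -- Rotation is the only trivial motion that turns the edge `(r, s)`.
  have hb : b = 0 := by
    have h1 := h r s hrs
    have h2 : v r - v s = a • (p r - p s) + b • perp (p r - p s) := by
      rw [hv r, hv s, perp_sub]; module
    rw [h2, inner_add_left, inner_smul_left, inner_smul_left, real_inner_comm, inner_perp_self,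
      real_inner_self_eq_norm_sq, norm_perp] at h1
    have h3 : ‖p r - p s‖ ≠ 0 := norm_ne_zero_iff.mpr (sub_ne_zero.mpr (hp.1 r s hrs.ne))
    simpa [h3] using h1
  exact ⟨a, ξ, fun i => by rw [hv i, hb]; simp⟩

/-- Connectedness of `G`: moving each vertex `i` by `β i` along the first axis leaves all edges
unchanged, so it is a scaling plus a translation, and the edge `(r, s)` rules out scaling. -/
theorem IsISAR.eq_of_adj_eq {n : ℕ} {G : SimpleGraph (Fin n)} {p : Config n}
    (hp : IsISAR G p) {r s : Fin n} (hrs : G.Adj r s) {β : Fin n → ℝ}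
    (h : ∀ i j, G.Adj i j → β i = β j) (i j : Fin n) : β i = β j := by
  obtain ⟨a, ξ, hv⟩ := hp.exists_eq_smul_add hrs
    (v := WithLp.toLp 2 fun i => β i • !₂[(1 : ℝ), 0])
    (fun i j hij => by simp [h i j hij])
  simp only at hv
  have h1 : a • (p r - p s) = 0 := by
    have := (hv r).symm.trans ((congrArg (· • !₂[(1 : ℝ), 0]) (h r s hrs)).trans (hv s))
    rw [smul_sub, sub_eq_zero]
    exact add_right_cancel this
  have ha : a = 0 := (smul_eq_zero.mp h1).resolve_right (sub_ne_zero.mpr (hp.1 r s hrs.ne))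
  have h2 := (hv i).trans (by rw [hv j, ha]; simp : _ = β j • !₂[(1 : ℝ), 0])
  have h3 := congrArg (fun x : Plane => x 0) h2
  simpa using h3

/-- The Poincaré inequality for the graph of an infinitesimally signed angle rigid framework. -/
theorem IsISAR.exists_poincare {n : ℕ} {G : SimpleGraph (Fin n)} [DecidableRel G.Adj]
    {p : Config n} (hp : IsISAR G p) {r s : Fin n} (hrs : G.Adj r s) :
    ∃ c : ℝ, 0 < c ∧ ∀ β : Fin n → ℝ, ∑ i, β i = 0 →
      ∑ i, β i ^ 2 ≤ c * ∑ i, ∑ j, if G.Adj i j then (β i - β j) ^ 2 else 0 := by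
  -- The second component removes the constants from the kernel and vanishes on the vectors of
  -- interest.
  let A : EuclideanSpace ℝ (Fin n) →ₗ[ℝ] EuclideanSpace ℝ (Fin n × Fin n) × ℝ :=
    { toFun := fun β => (WithLp.toLp 2 fun e => if G.Adj e.1 e.2 then β e.1 - β e.2 else 0,
        ∑ i, β i)
      map_add' := fun x y => by
        ext e
        · by_cases h : G.Adj e.1 e.2 <;> simp [h]; ring
        · simp [Finset.sum_add_distrib]
      map_smul' := fun c x => by
        ext e
        · by_cases h : G.Adj e.1 e.2 <;> simp [h]; ring
        · simp [Finset.mul_sum] }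
  obtain ⟨c, hc, hle⟩ := exists_norm_le_of_ker_le A LinearMap.id (fun β hβ => by
    have h1 : ∀ i j, G.Adj i j → β i = β j := fun i j hij => by
      have := congrArg (fun z : EuclideanSpace ℝ (Fin n × Fin n) × ℝ => z.1 (i, j)) hβ
      simpa [A, hij, sub_eq_zero] using this
    have h2 : ∑ i, β i = 0 := congrArg Prod.snd hβ
    ext i
    have h3 : ∑ j, β j = n * β i := by
      rw [Finset.sum_congr rfl fun j _ => hp.eq_of_adj_eq hrs h1 j i]; simp
    have hn : (n : ℝ) ≠ 0 := Nat.cast_ne_zero.mpr (by have := i.2; lia)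
    simpa [h2, hn] using h3.symm)
  refine ⟨c ^ 2, by positivity, fun β hβ => ?_⟩
  have h1 := hle (WithLp.toLp 2 β)
  have h2 : ‖A (WithLp.toLp 2 β)‖ = ‖(A (WithLp.toLp 2 β)).1‖ := by
    have : (A (WithLp.toLp 2 β)).2 = 0 := hβ
    rw [Prod.norm_def, this, norm_zero]
    exact max_eq_left (norm_nonneg _)
  rw [h2] at h1
  have h3 := pow_le_pow_left₀ (norm_nonneg _) h1 2
  rw [mul_pow, EuclideanSpace.norm_sq_eq, EuclideanSpace.norm_sq_eq, Fintype.sum_prod_type] at h3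
  simpa [A, apply_ite (fun x : ℝ => x ^ 2)] using h3

/-- Bearing rigidity in quantitative form, for a centred copy `q` of the framework. -/
theorem exists_bearing_coercive {n : ℕ} {G : SimpleGraph (Fin n)} [DecidableRel G.Adj]
    {q : Config n} (hq : ∑ i, q i = 0)
    (hrig : ∀ v : Config n, (∀ i j, G.Adj i j → inner ℝ (v i - v j) (perp (q i - q j)) = 0) →
      ∃ (a : ℝ) (ξ : Plane), ∀ i, v i = a • q i + ξ) :
    ∃ c : ℝ, 0 < c ∧ ∀ v : Config n, ∑ i, v i = 0 →
      ‖q‖ ^ 2 * (‖q‖ ^ 2 * ‖v‖ ^ 2 - inner ℝ v q ^ 2) ≤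
        c * ∑ i, ∑ j, if G.Adj i j then inner ℝ (v i - v j) (perp (q i - q j)) ^ 2 else 0 := by
  let A : Config n →ₗ[ℝ] EuclideanSpace ℝ (Fin n × Fin n) × Plane :=
    { toFun := fun v => (WithLp.toLp 2 fun e =>
        if G.Adj e.1 e.2 then inner ℝ (v e.1 - v e.2) (perp (q e.1 - q e.2)) else 0, ∑ i, v i)
      map_add' := fun x y => by
        refine Prod.ext (PiLp.ext fun e => ?_) ?_
        · by_cases h : G.Adj e.1 e.2 <;> simp [h, inner_sub_left, inner_add_left]; ring
        · simp [Finset.sum_add_distrib]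
      map_smul' := fun c x => by
        refine Prod.ext (PiLp.ext fun e => ?_) ?_
        · by_cases h : G.Adj e.1 e.2 <;> simp [h, inner_sub_left, inner_smul_left]; ring
        · simp [Finset.smul_sum] }
  -- `‖q‖ ^ 2` times the projection orthogonal to `q`, which avoids dividing by a possibly zero
  -- norm.
  let B : Config n →ₗ[ℝ] Config n :=
    { toFun := fun v => ‖q‖ ^ 2 • v - (inner ℝ v q : ℝ) • q
      map_add' := fun x y => by rw [inner_add_left]; module
      map_smul' := fun c x => by rw [inner_smul_left]; simp; module }
  obtain ⟨c, hc, hle⟩ := exists_norm_le_of_ker_le A B (fun v hv => by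
    have h1 : ∀ i j, G.Adj i j → inner ℝ (v i - v j) (perp (q i - q j)) = 0 := fun i j hij => by
      have := congrArg (fun z : EuclideanSpace ℝ (Fin n × Fin n) × Plane => z.1 (i, j)) hv
      simpa [A, hij] using this
    have h2 : ∑ i, v i = 0 := congrArg Prod.snd hv
    obtain ⟨a, ξ, hvi⟩ := hrig v h1
    have hξ : (n : ℝ) • ξ = 0 := by
      rw [Finset.sum_congr rfl fun i _ => hvi i, Finset.sum_add_distrib, ← Finset.smul_sum, hq] at h2
      simpa [Nat.cast_smul_eq_nsmul] using h2
    have hv' : v = a • q := by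
      refine PiLp.ext fun i => ?_
      have hn : (n : ℝ) ≠ 0 := Nat.cast_ne_zero.mpr (by have := i.2; lia)
      have hξ0 : ξ = 0 := (smul_eq_zero.mp hξ).resolve_left hn
      rw [hvi i, hξ0]; simp
    change ‖q‖ ^ 2 • v - (inner ℝ v q : ℝ) • q = 0
    rw [hv', inner_smul_left, real_inner_self_eq_norm_sq, smul_smul, sub_eq_zero]
    simp [mul_comm])
  refine ⟨c ^ 2, by positivity, fun v hv => ?_⟩
  have h1 := hle v
  have h2 : ‖A v‖ = ‖(A v).1‖ := by
    have : (A v).2 = 0 := hv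
    rw [Prod.norm_def, this, norm_zero]
    exact max_eq_left (norm_nonneg _)
  rw [h2] at h1
  have h3 := pow_le_pow_left₀ (norm_nonneg _) h1 2
  have h4 : ‖B v‖ ^ 2 = ‖q‖ ^ 2 * (‖q‖ ^ 2 * ‖v‖ ^ 2 - inner ℝ v q ^ 2) := by
    change ‖‖q‖ ^ 2 • v - (inner ℝ v q : ℝ) • q‖ ^ 2 = _
    rw [norm_sub_sq_real, norm_smul, norm_smul, inner_smul_left, inner_smul_right]
    simp only [mul_pow, norm_pow, Real.norm_eq_abs, sq_abs, conj_trivial]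
    ring
  rw [h4, mul_pow, EuclideanSpace.norm_sq_eq, Fintype.sum_prod_type] at h3
  simpa [A, apply_ite (fun x : ℝ => x ^ 2)] using h3

/-! ### Summation by parts and attitude consensus -/

theorem sum_inner_sum_of_antisymm {ι E : Type*} [Fintype ι] [NormedAddCommGroup E]
    [InnerProductSpace ℝ E] {F : ι → ι → E} (hF : ∀ i j, F j i = -F i j) (y : ι → E) :
    ∑ i, inner ℝ (y i) (∑ j, F i j) = (1 / 2) * ∑ i, ∑ j, inner ℝ (y i - y j) (F i j) := by
  have h1 : ∑ i, ∑ j, inner ℝ (y j) (F i j) = -∑ i, ∑ j, inner ℝ (y i) (F i j) := by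
    rw [Finset.sum_comm, ← Finset.sum_neg_distrib]
    refine Finset.sum_congr rfl fun i _ => ?_
    rw [← Finset.sum_neg_distrib]
    exact Finset.sum_congr rfl fun j _ => by rw [hF i j, inner_neg_right]
  simp only [inner_sum, inner_sub_left, Finset.sum_sub_distrib, h1]
  ring

/-- The mean is conserved, and the squared deviation from it decays at the rate given by the
Poincaré inequality. -/
theorem attitude_consensus {n : ℕ} {G : SimpleGraph (Fin n)} [DecidableRel G.Adj]
    {pstar : Config n} (hstar : IsISAR G pstar) {r s : Fin n} (hrs : G.Adj r s)
    {β : ℝ → Fin n → ℝ}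
    (hβ : ∀ t, 0 ≤ t → ∀ i, HasDerivWithinAt (fun τ => β τ i) (attitudeInput G (β t) i)
      (Set.Ici 0) t) :
    ∃ b K ν : ℝ, 0 ≤ K ∧ 0 < ν ∧ ∀ t, 0 ≤ t → ∀ i, |β t i - b| ≤ K * Real.exp (-ν * t) := by
  obtain ⟨c, hc, hpoin⟩ := hstar.exists_poincare hrs
  have hn : (n : ℝ) ≠ 0 := Nat.cast_ne_zero.mpr (by have := r.2; lia)
  have hinput : ∀ t i, attitudeInput G (β t) i =
      -∑ j, if G.Adj i j then β t i - β t j else 0 := fun t i => by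
    rw [attitudeInput, SimpleGraph.neighborFinset_eq_filter, Finset.sum_filter]
  have hanti : ∀ t i j, (if G.Adj j i then β t j - β t i else 0) =
      -(if G.Adj i j then β t i - β t j else 0) := fun t i j => by
    by_cases h : G.Adj i j
    · simp [h, h.symm]
    · simp [h, G.adj_comm j i]
  have hsum := fun t (y : Fin n → ℝ) => sum_inner_sum_of_antisymm (hanti t) y
  simp only [RCLike.inner_apply, conj_trivial] at hsum
  have hmean : ∀ t, 0 ≤ t → ∑ i, β t i = ∑ i, β 0 i := fun t ht => by
    refine eq_of_hasDerivWithinAt_zero (f := fun t => ∑ i, β t i) (fun t ht => ?_) ht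
    have h1 := HasDerivWithinAt.fun_sum (u := Finset.univ) fun i _ => hβ t ht i
    have h2 := hsum t fun _ => 1
    simp only [mul_one, sub_self, mul_zero, Finset.sum_const_zero] at h2
    have h3 : ∑ i, attitudeInput G (β t) i = 0 := by
      simp only [hinput, Finset.sum_neg_distrib, h2, neg_zero]
    rwa [h3] at h1
  set b := (∑ i, β 0 i) / n with hb
  have hzero : ∀ t, 0 ≤ t → ∑ i, (β t i - b) = 0 := fun t ht => by
    rw [Finset.sum_sub_distrib, hmean t ht]
    simp only [Finset.sum_const, Finset.card_univ, Fintype.card_fin, nsmul_eq_mul, hb]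
    field_simp
    ring
  have hder : ∀ t, 0 ≤ t → HasDerivWithinAt (fun t => ∑ i, (β t i - b) ^ 2)
      (-∑ i, ∑ j, if G.Adj i j then (β t i - β t j) ^ 2 else 0) (Set.Ici 0) t := fun t ht => by
    have h1 := HasDerivWithinAt.fun_sum (u := Finset.univ)
      fun i _ => ((hβ t ht i).sub_const b).fun_pow 2
    refine h1.congr_deriv ?_
    have h2 := hsum t fun i => β t i - b
    have h3 : ∑ i, ((2 : ℕ) : ℝ) * (β t i - b) ^ (2 - 1) * attitudeInput G (β t) i =
        -(2 * ∑ i, (∑ j, if G.Adj i j then β t i - β t j else 0) * (β t i - b)) := by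
      rw [Finset.mul_sum, ← Finset.sum_neg_distrib]
      refine Finset.sum_congr rfl fun i _ => ?_
      rw [hinput]; push_cast; ring
    rw [h3, h2, ← mul_assoc]
    norm_num
    refine Finset.sum_congr rfl fun i _ => Finset.sum_congr rfl fun j _ => ?_
    split_ifs <;> ring
  set W := ∑ i, (β 0 i - b) ^ 2 with hW
  have hW0 : 0 ≤ W := Finset.sum_nonneg fun i _ => sq_nonneg _
  -- The square root of a quantity decaying at rate `c⁻¹` decays at half that rate.
  refine ⟨b, √W, c⁻¹ / 2, Real.sqrt_nonneg _, by positivity, fun t ht i => ?_⟩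
  have h1 := le_exp_of_deriv_le (k := c⁻¹) le_rfl hder (fun t ht => by
    have h2 := hpoin _ (hzero t ht)
    simp only [sub_sub_sub_cancel_right] at h2
    rw [neg_mul, neg_le_neg_iff, inv_mul_le_iff₀ hc]
    exact h2) ht
  rw [mul_zero, Real.exp_zero, mul_one] at h1
  have h3 : (β t i - b) ^ 2 ≤ ∑ i, (β t i - b) ^ 2 :=
    Finset.single_le_sum (f := fun i => (β t i - b) ^ 2) (fun i _ => sq_nonneg _)
      (Finset.mem_univ i)
  refine abs_le_of_sq_le_sq (h3.trans (h1.trans ?_)) (by positivity)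
  rw [mul_pow, Real.sq_sqrt hW0, ← Real.exp_nat_mul]
  refine le_of_eq ?_
  congr 2
  push_cast
  ring

/-! ### Antisymmetric flows on the sphere of centred configurations -/

section Flow

variable {n : ℕ} {w : ℝ → Config n} {F : ℝ → Fin n → Fin n → Plane}

theorem sum_conserved
    (hw : ∀ t, 0 ≤ t → ∀ i, HasDerivWithinAt (fun τ => w τ i) (-∑ j, F t i j) (Set.Ici 0) t)
    (hF : ∀ t i j, F t j i = -F t i j) {t : ℝ} (ht : 0 ≤ t) : ∑ i, w t i = ∑ i, w 0 i := by
  refine ext_inner_left ℝ fun u => ?_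
  refine eq_of_hasDerivWithinAt_zero (f := fun t => inner ℝ u (∑ i, w t i)) (fun t ht => ?_) ht
  have h1 := (hasDerivWithinAt_const t (Set.Ici (0 : ℝ)) u).inner ℝ
    (HasDerivWithinAt.fun_sum (u := Finset.univ) fun i _ => hw t ht i)
  have h2 := sum_inner_sum_of_antisymm (hF t) fun _ => u
  simp only [sub_self, inner_zero_left, Finset.sum_const_zero, mul_zero] at h2
  refine h1.congr_deriv ?_
  rw [inner_zero_left, add_zero, Finset.sum_neg_distrib, inner_neg_right, inner_sum, h2, neg_zero]

theorem norm_conserved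
    (hw : ∀ t, 0 ≤ t → ∀ i, HasDerivWithinAt (fun τ => w τ i) (-∑ j, F t i j) (Set.Ici 0) t)
    (hF : ∀ t i j, F t j i = -F t i j) (horth : ∀ t i j, inner ℝ (w t i - w t j) (F t i j) = 0)
    {t : ℝ} (ht : 0 ≤ t) : ‖w t‖ = ‖w 0‖ := by
  rw [← sq_eq_sq₀ (norm_nonneg _) (norm_nonneg _)]
  refine eq_of_hasDerivWithinAt_zero (f := fun t => ‖w t‖ ^ 2) (fun t ht => ?_) ht
  have hsq : ∀ v : Config n, ‖v‖ ^ 2 = ∑ i, ‖v i‖ ^ 2 := PiLp.norm_sq_eq_of_L2 _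
  simp only [hsq]
  have h1 := HasDerivWithinAt.fun_sum (u := Finset.univ) fun i _ => (hw t ht i).norm_sq
  have h2 := sum_inner_sum_of_antisymm (hF t) fun i => w t i
  simp only [horth, Finset.sum_const_zero, mul_zero] at h2
  refine h1.congr_deriv ?_
  rw [← Finset.mul_sum]
  simp only [inner_neg_right, Finset.sum_neg_distrib, h2, neg_zero, mul_zero]

theorem norm_sub_le_of_inner_le {v q : Config n} {S x K ν t : ℝ} (hS : 0 < S) (hv : ‖v‖ = S)
    (hq : ‖q‖ = S) (hx : 1 - inner ℝ v q / S ^ 2 = x) (h : x ≤ K * Real.exp (-ν * t)) :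
    ‖v - q‖ ≤ √(2 * S ^ 2 * K) * Real.exp (-(ν / 2) * t) := by
  have h1 : ‖v - q‖ ^ 2 = 2 * S ^ 2 * x := by
    rw [norm_sub_sq_real, hv, hq, ← hx]; field_simp; ring
  have hK : 0 ≤ K := by
    have h2 : 0 ≤ 2 * S ^ 2 * x := h1 ▸ sq_nonneg _
    have h3 : 0 ≤ x := nonneg_of_mul_nonneg_right h2 (by positivity)
    exact nonneg_of_mul_nonneg_left (h3.trans h) (Real.exp_pos _)
  refine abs_le_of_sq_le_sq' ?_ (by positivity) |>.2
  have h4 : Real.exp (-(ν / 2) * t) ^ 2 = Real.exp (-ν * t) := by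
    rw [← Real.exp_nat_mul]; congr 1; push_cast; ring
  rw [h1, mul_pow, Real.sq_sqrt (by positivity), h4, mul_assoc _ K]
  gcongr

/-- On the sphere of centred configurations of fixed size, a flow that is driven towards `q` up to
an exponentially small error tends exponentially to `q` or to `-q`. -/
theorem sphere_flow_converges
    (hw : ∀ t, 0 ≤ t → ∀ i, HasDerivWithinAt (fun τ => w τ i) (-∑ j, F t i j) (Set.Ici 0) t)
    (hF : ∀ t i j, F t j i = -F t i j) {q : Config n} {S a c C lam : ℝ} (hS : 0 < S) (ha : 0 < a)
    (hc : 0 < c) (hC : 0 ≤ C) (hlam : 0 < lam)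
    (hnorm : ∀ t, 0 ≤ t → ‖w t‖ = S) (hq : ‖q‖ = S) {d : ℝ → Fin n → Fin n → ℝ}
    (hcoer : ∀ t, 0 ≤ t → ‖q‖ ^ 2 * (‖q‖ ^ 2 * ‖w t‖ ^ 2 - inner ℝ (w t) q ^ 2) ≤
      c * ∑ i, ∑ j, d t i j)
    (hdrive : ∀ t, 0 ≤ t → ∀ i j,
      inner ℝ (q i - q j) (F t i j) ≤ -a * d t i j + C * Real.exp (-lam * t)) :
    ∃ K ν : ℝ, 0 < ν ∧ ((∀ t, 0 ≤ t → ‖w t - q‖ ≤ K * Real.exp (-ν * t)) ∨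
      ∀ t, 0 ≤ t → ‖w t - -q‖ ≤ K * Real.exp (-ν * t)) := by
  -- On the sphere this quantity equals `‖w t - q‖ ^ 2 / (2 * S ^ 2)`, with values in `[0, 2]`.
  have hder : ∀ t, 0 ≤ t → HasDerivWithinAt (fun t => 1 - inner ℝ (w t) q / S ^ 2)
      (1 / (2 * S ^ 2) * ∑ i, ∑ j, inner ℝ (q i - q j) (F t i j)) (Set.Ici 0) t := fun t ht => by
    have hinner : ∀ v : Config n, inner ℝ v q = ∑ i, inner ℝ (v i) (q i) :=
      fun v => PiLp.inner_apply v q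
    simp only [hinner]
    have h1 := (((HasDerivWithinAt.fun_sum (u := Finset.univ) fun i _ =>
      (hw t ht i).inner ℝ (hasDerivWithinAt_const t (Set.Ici (0 : ℝ)) (q i))).div_const
        (S ^ 2)).const_sub 1)
    refine h1.congr_deriv ?_
    have h2 := sum_inner_sum_of_antisymm (hF t) fun i => q i
    have h3 : ∑ i, (inner ℝ (w t i) 0 + inner ℝ (-∑ j, F t i j) (q i)) =
        -∑ i, inner ℝ (q i) (∑ j, F t i j) := by
      rw [← Finset.sum_neg_distrib]
      refine Finset.sum_congr rfl fun i _ => ?_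
      rw [inner_zero_right, zero_add, inner_neg_left, real_inner_comm]
    rw [h3, h2]
    field_simp
  have hcs : ∀ t, 0 ≤ t → |inner ℝ (w t) q| ≤ S ^ 2 := fun t ht => by
    have := abs_real_inner_le_norm (w t) q
    rwa [hnorm t ht, hq, ← sq] at this
  have hS2 : (0 : ℝ) < S ^ 2 := by positivity
  -- In terms of `x`, the left side of `hcoer` is `S ^ 6 * x * (2 - x)`; the factor `1 / (2 * S ^
  -- 2)` of `hder` yields `k`, and the `n ^ 2` ordered pairs yield the error constant.
  obtain ⟨K, ν, hK, hν, h⟩ := logistic_dichotomy (k := a * S ^ 4 / (2 * c))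
    (C := n ^ 2 * C / (2 * S ^ 2)) (by positivity) (by positivity) hlam hder
    (fun t ht => by
      have := (abs_le.mp (hcs t ht)).2
      rw [sub_nonneg, div_le_one hS2]; exact this)
    (fun t ht => by
      have := (abs_le.mp (hcs t ht)).1
      have : -1 ≤ inner ℝ (w t) q / S ^ 2 := by rw [le_div_iff₀ hS2]; linarith
      linarith)
    (fun t ht => by
      have h1 : ∑ i, ∑ j, inner ℝ (q i - q j) (F t i j) ≤
          ∑ i : Fin n, ∑ j : Fin n, (-a * d t i j + C * Real.exp (-lam * t)) :=
        Finset.sum_le_sum fun i _ => Finset.sum_le_sum fun j _ => hdrive t ht i j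
      simp only [Finset.sum_add_distrib, ← Finset.mul_sum, Finset.sum_const, Finset.card_univ,
        Fintype.card_fin, nsmul_eq_mul] at h1
      have h2 := hcoer t ht
      rw [hq, hnorm t ht] at h2
      set D := ∑ i, ∑ j, d t i j
      set y := (inner ℝ (w t) q : ℝ)
      have h3 : -(a * D) ≤ -(a * (S ^ 2 * (S ^ 2 * S ^ 2 - y ^ 2) / c)) := by
        rw [neg_le_neg_iff]
        gcongr
        rw [div_le_iff₀ hc]; linarith
      calc 1 / (2 * S ^ 2) * ∑ i, ∑ j, inner ℝ (q i - q j) (F t i j)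
          ≤ 1 / (2 * S ^ 2) * (-(a * (S ^ 2 * (S ^ 2 * S ^ 2 - y ^ 2) / c)) +
              n * (n * (C * Real.exp (-lam * t)))) := by
            gcongr; linarith
        _ = _ := by field_simp; ring)
  refine ⟨√(2 * S ^ 2 * K), ν / 2, by positivity, h.imp (fun h t ht => ?_) (fun h t ht => ?_)⟩
  · exact norm_sub_le_of_inner_le hS (hnorm t ht) hq rfl (h t ht)
  · refine norm_sub_le_of_inner_le hS (hnorm t ht) (by rw [norm_neg, hq]) ?_ (h t ht)
    rw [inner_neg_right]; ring

end Flow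

/-! ### The force of a single edge -/

theorem bearing_drive {n : ℕ} {w q : Config n} {i j : Fin n} {S e : ℝ} {f : Plane}
    (hw : w i ≠ w j) (hq : q i ≠ q j) (hwS : ‖w‖ = S) (hqS : ‖q‖ = S)
    (hf : ‖f - (2 : ℝ) • bearing q i j‖ ≤ e) :
    inner ℝ (q i - q j) (normalPart (bearing w i j) f) ≤
      -(1 / (4 * S ^ 3)) * inner ℝ (w i - w j) (perp (q i - q j)) ^ 2 + 2 * S * e := by
  have hdist : ∀ v : Config n, ‖v‖ = S → ‖v j - v i‖ ≤ 2 * S := fun v hv => by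
    have h1 := PiLp.norm_apply_le v i
    have h2 := PiLp.norm_apply_le v j
    linarith [norm_sub_le (v j) (v i)]
  have hd : 0 < ‖w j - w i‖ := norm_pos_iff.mpr (sub_ne_zero.mpr hw.symm)
  have hl : 0 < ‖q j - q i‖ := norm_pos_iff.mpr (sub_ne_zero.mpr hq.symm)
  have hdS := hdist w hwS
  have hlS := hdist q hqS
  have hS : 0 < S := by linarith
  have hnb : ‖bearing w i j‖ = 1 := norm_bearing hw
  have hnq : ‖bearing q i j‖ = 1 := norm_bearing hq
  have hwb : w i - w j = -(‖w j - w i‖ • bearing w i j) := by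
    rw [bearing, smul_smul, mul_inv_cancel₀ hd.ne', one_smul, neg_sub]
  have hqb : q i - q j = -(‖q j - q i‖ • bearing q i j) := by
    rw [bearing, smul_smul, mul_inv_cancel₀ hl.ne', one_smul, neg_sub]
  rw [hwb, hqb]
  set d := ‖w j - w i‖
  set l := ‖q j - q i‖
  set b := bearing w i j
  set u := bearing q i j
  -- The sine of the angle from the current bearing to the desired one.
  set y := (inner ℝ (perp b) u : ℝ) with hy
  have hswap : inner ℝ (-(d • b)) (perp (-(l • u))) = -(d * l * y) := by
    rw [perp_neg, perp_smul, inner_neg_neg, inner_smul_left, inner_smul_right, hy, inner_perp_swap]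
    simp; ring
  have hpert : inner ℝ (perp b) f = 2 * y + inner ℝ (perp b) (f - (2 : ℝ) • u) := by
    rw [inner_sub_right, inner_smul_right]; ring
  set z := (inner ℝ (perp b) (f - (2 : ℝ) • u) : ℝ)
  have hz : |z| ≤ e := by
    refine (abs_real_inner_le_norm _ _).trans ?_
    rwa [norm_perp, hnb, one_mul]
  have hy1 : |y| ≤ 1 := by
    have := abs_real_inner_le_norm (perp b) u
    rwa [norm_perp, hnb, hnq, one_mul] at this
  have hlhs : inner ℝ (-(l • u)) (normalPart b f) = -(l * ((2 * y + z) * y)) := by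
    rw [normalPart, inner_neg_left, inner_smul_left, inner_smul_right, hpert, real_inner_comm, ← hy]
    simp
  rw [hlhs, hswap]
  have h1 : -(z * y) ≤ e := by
    have h2 := neg_abs_le (z * y)
    rw [abs_mul] at h2
    nlinarith [mul_le_mul hz hy1 (abs_nonneg _) ((abs_nonneg _).trans hz)]
  have he : 0 ≤ e := (abs_nonneg _).trans hz
  have h3 : l * -(z * y) ≤ 2 * S * e :=
    (mul_le_mul_of_nonneg_left h1 hl.le).trans (by gcongr)
  -- Distances in a configuration of norm `S` are at most `2 * S`, so `d ^ 2 * l ≤ 8 * S ^ 3`. No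
  -- lower bound on `d` is needed, so near-collisions do no harm.
  have h4 : 1 / (4 * S ^ 3) * (-(d * l * y)) ^ 2 ≤ 2 * l * y ^ 2 := by
    have h5 : d ^ 2 * l ≤ (2 * S) ^ 2 * (2 * S) := by gcongr
    rw [div_mul_eq_mul_div, one_mul, div_le_iff₀ (by positivity)]
    calc (-(d * l * y)) ^ 2 = d ^ 2 * l * (l * y ^ 2) := by ring
      _ ≤ (2 * S) ^ 2 * (2 * S) * (l * y ^ 2) := by gcongr
      _ = _ := by ring
  linarith

/-- The control force that the edge `(i, j)` exerts on agent `i`, in global coordinates. -/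
def edgeForce {n : ℕ} (G : SimpleGraph (Fin n)) [DecidableRel G.Adj] (pstar : Config n) (θ : ℝ)
    (p : Config n) (β : Fin n → ℝ) (i j : Fin n) : Plane :=
  if G.Adj i j then normalPart (bearing p i j)
    (act (rot (β i - θ + Real.pi / 2)) (bearing pstar i j) +
      act (rot (β j - θ + Real.pi / 2)) (bearing pstar i j)) else 0

section EdgeForce

variable {n : ℕ} (G : SimpleGraph (Fin n)) [DecidableRel G.Adj] (pstar : Config n) (θ : ℝ)
  (p : Config n) (β : Fin n → ℝ)

/-- The force is symmetric in the two attitudes, odd in the target bearing and even in the current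
one. -/
theorem edgeForce_swap (i j : Fin n) :
    edgeForce G pstar θ p β j i = -edgeForce G pstar θ p β i j := by
  by_cases h : G.Adj i j
  · rw [edgeForce, edgeForce, if_pos h, if_pos h.symm, bearing_swap p i j, bearing_swap pstar i j,
      normalPart_neg, act_neg, act_neg, ← neg_add, normalPart_neg_right, add_comm]
  · rw [edgeForce, edgeForce, if_neg h, if_neg (fun h' => h h'.symm), neg_zero]

theorem inner_edgeForce (i j : Fin n) :
    inner ℝ (p i - p j) (edgeForce G pstar θ p β i j) = 0 := by
  rw [edgeForce]
  split_ifs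
  · have h : inner ℝ (p i - p j) (perp (bearing p i j)) = 0 := by
      rw [real_inner_comm, bearing, perp_smul, inner_smul_left, ← neg_sub (p j), inner_neg_right,
        inner_perp_self, neg_zero, mul_zero]
    rw [normalPart, inner_smul_right, h, mul_zero]
  · exact inner_zero_right _

variable {G pstar θ p β}

theorem rot_positionInput {r s : Fin n} (hstar : IsFramework G pstar) (hrs : G.Adj r s)
    (hθ : act (rot θ) !₂[(1 : ℝ), 0] = bearing pstar r s)
    (hp : ∀ i j, G.Adj i j → p i ≠ p j) (i : Fin n) :
    act (rot (β i)) (positionInput G pstar r s p β i) =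
      -∑ j, edgeForce G pstar θ p β i j := by
  rw [positionInput, SimpleGraph.neighborFinset_eq_filter, Finset.sum_filter, act_neg, act_sum]
  congr 1
  refine Finset.sum_congr rfl fun j _ => ?_
  rw [edgeForce]
  split_ifs with h
  · exact rot_Rbar_eta (hp i j h) (hstar i j h.ne) (hstar r s hrs.ne) hθ β
  · exact map_zero (actHom _)

end EdgeForce

/-! ### Similar copies and centring -/

theorem bearing_similar {n : ℕ} {p q : Config n} {κ φ : ℝ} {ξ : Plane} (hκ : 0 < κ)
    (hq : ∀ i, q i = κ • act (rot φ) (p i) + ξ) (i j : Fin n) :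
    bearing q i j = act (rot φ) (bearing p i j) := by
  have h : q j - q i = κ • act (rot φ) (p j - p i) := by
    rw [hq, hq, act_sub]; module
  rw [bearing, bearing, h, norm_smul, norm_rot, act_smul, smul_smul, Real.norm_of_nonneg hκ.le]
  congr 1
  field_simp

theorem norm_rot_add_rot_sub_le {a b φ e : ℝ} {x : Plane} (hx : ‖x‖ = 1) (ha : |a - φ| ≤ e)
    (hb : |b - φ| ≤ e) :
    ‖act (rot a) x + act (rot b) x - (2 : ℝ) • act (rot φ) x‖ ≤ 2 * e := by
  have h1 := norm_rot_sub_rot_le a φ x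
  have h2 := norm_rot_sub_rot_le b φ x
  rw [hx, mul_one] at h1 h2
  have h3 : act (rot a) x + act (rot b) x - (2 : ℝ) • act (rot φ) x =
      (act (rot a) x - act (rot φ) x) + (act (rot b) x - act (rot φ) x) := by module
  rw [h3]
  linarith [norm_add_le (act (rot a) x - act (rot φ) x) (act (rot b) x - act (rot φ) x)]

theorem mem_similarityClass {n : ℕ} {p q : Config n} {c φ : ℝ} {ξ : Plane} (hc : c ≠ 0)
    (hq : ∀ i, q i = c • act (rot φ) (p i) + ξ) : q ∈ similarityClass p := by
  refine ⟨toIcoMod Real.two_pi_pos 0 φ, by simpa using toIcoMod_mem_Ico Real.two_pi_pos 0 φ,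
    c, hc, ξ, fun i => ?_⟩
  have h : rot (toIcoMod Real.two_pi_pos 0 φ) = rot φ := by
    rw [rot, rot, toIcoMod, zsmul_eq_mul, Real.cos_sub_int_mul_two_pi, Real.sin_sub_int_mul_two_pi]
  rw [h, hq]

/-- Rotating `v` back by `-φ` reduces the edge conditions to those of `p`. -/
theorem IsISAR.exists_eq_smul_add_of_similar {n : ℕ} {G : SimpleGraph (Fin n)} {p q : Config n}
    (hp : IsISAR G p) {r s : Fin n} (hrs : G.Adj r s) {κ φ : ℝ} {ξ : Plane} (hκ : 0 < κ)
    (hq : ∀ i, q i = κ • act (rot φ) (p i) + ξ) {v : Config n}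
    (hv : ∀ i j, G.Adj i j → inner ℝ (v i - v j) (perp (q i - q j)) = 0) :
    ∃ (a : ℝ) (ζ : Plane), ∀ i, v i = a • q i + ζ := by
  obtain ⟨a, ζ, h⟩ := hp.exists_eq_smul_add hrs
    (v := WithLp.toLp 2 fun i => act (rot (-φ)) (v i)) (fun i j hij => by
      have h1 := hv i j hij
      have h2 : q i - q j = κ • act (rot φ) (p i - p j) := by
        rw [hq, hq, act_sub]; module
      rw [h2, perp_smul, perp_rot, inner_smul_right, mul_eq_zero, or_iff_right hκ.ne',
        ← inner_rot (-φ), rot_rot, neg_add_cancel, rot_zero_act, act_sub] at h1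
      exact h1)
  refine ⟨a / κ, act (rot φ) ζ - (a / κ) • ξ, fun i => ?_⟩
  have h1 := congrArg (act (rot φ)) (h i)
  simp only [rot_rot, add_neg_cancel, rot_zero_act, act_add, act_smul] at h1
  rw [h1, hq, smul_add, smul_smul, div_mul_cancel₀ _ hκ.ne']
  module

/-- The configuration `p` moved so that its centroid is the origin. -/
def centered {n : ℕ} (p : Config n) : Config n :=
  WithLp.toLp 2 fun i => p i - (n : ℝ)⁻¹ • ∑ j, p j

theorem sum_centered {n : ℕ} (hn : n ≠ 0) (p : Config n) : ∑ i, centered p i = 0 := by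
  have : (n : ℝ) ≠ 0 := Nat.cast_ne_zero.mpr hn
  simp [centered, Finset.sum_sub_distrib, ← Nat.cast_smul_eq_nsmul ℝ, smul_smul, this]

theorem centered_sub {n : ℕ} (p : Config n) (i j : Fin n) :
    centered p i - centered p j = p i - p j := by simp [centered]

theorem norm_centered_pos {n : ℕ} {p : Config n} {i j : Fin n} (h : p i ≠ p j) :
    0 < ‖centered p‖ := by
  refine norm_pos_iff.mpr fun h0 => h (sub_eq_zero.mp ?_)
  rw [← centered_sub, h0]; simp

end SignedAngle

end

/-! ### Global convergence -/

theorem theorem11 (n : ℕ) (hn : 3 ≤ n)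
    (G : SimpleGraph (Fin n)) [DecidableRel G.Adj]
    (pstar : SignedAngle.Config n) (hstar : SignedAngle.IsISAR G pstar)
    (r s : Fin n) (hrs : G.Adj r s)
    (p : ℝ → SignedAngle.Config n) (β : ℝ → Fin n → ℝ)
    (hmeas : ∀ t : ℝ, 0 ≤ t → ∀ i j : Fin n, G.Adj i j → p t i ≠ p t j)
    (hdyn : SignedAngle.FollowsDynamics p β
      (fun t i => SignedAngle.positionInput G pstar r s (p t) (β t) i)
      (fun t i => SignedAngle.attitudeInput G (β t) i)) :
    ∃ q ∈ SignedAngle.similarityClass pstar, ∃ C : ℝ, 0 < C ∧ ∃ lam : ℝ, 0 < lam ∧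
      ∀ t : ℝ, 0 ≤ t → ‖p t - q‖ ≤ C * Real.exp (-lam * t) := by
  open SignedAngle in
  obtain ⟨θ, hθ⟩ := exists_rot_eq (norm_bearing (hstar.1 r s hrs.ne))
  obtain ⟨b, K, ν, hK, hν, hb⟩ := attitude_consensus hstar hrs (fun t ht i => (hdyn t ht i).2)
  -- Here `-θ` undoes the direction of the reference edge, and the quarter turn comes from the
  -- vector `[0, cos]` in `eta`.
  set φ := b - θ + Real.pi / 2 with hφ
  set F : ℝ → Fin n → Fin n → Plane := fun t => edgeForce G pstar θ (p t) (β t) with hF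
  have hp : ∀ t, 0 ≤ t → ∀ i, HasDerivWithinAt (fun τ => p τ i) (-∑ j, F t i j) (Set.Ici 0) t :=
    fun t ht i => ((hdyn t ht i).1).congr_deriv
      (rot_positionInput hstar.1 hrs hθ (hmeas t ht) i)
  have hanti : ∀ t i j, F t j i = -F t i j := fun t => edgeForce_swap G pstar θ (p t) (β t)
  set m : Plane := (n : ℝ)⁻¹ • ∑ j, p 0 j with hm
  set w : ℝ → Config n := fun t => WithLp.toLp 2 fun i => p t i - m with hw_def
  have hwsub : ∀ t i j, w t i - w t j = p t i - p t j := fun t i j => by simp [hw_def]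
  have hw : ∀ t, 0 ≤ t → ∀ i, HasDerivWithinAt (fun τ => w τ i) (-∑ j, F t i j) (Set.Ici 0) t :=
    fun t ht i => (hp t ht i).sub_const m
  have hw0 : w 0 = centered (p 0) := rfl
  have hwsum : ∀ t, 0 ≤ t → ∑ i, w t i = 0 := fun t ht => by
    rw [sum_conserved hw hanti ht, hw0, sum_centered (by lia)]
  set S := ‖w 0‖ with hS
  have hSpos : 0 < S := norm_centered_pos (hmeas 0 le_rfl r s hrs)
  have hwS : ∀ t, 0 ≤ t → ‖w t‖ = S := fun t ht => norm_conserved hw hanti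
    (fun t i j => by rw [hwsub]; exact inner_edgeForce G pstar θ (p t) (β t) i j) ht
  have hT : 0 < ‖centered pstar‖ := norm_centered_pos (hstar.1 r s hrs.ne)
  set κ := S / ‖centered pstar‖ with hκ_def
  have hκ : 0 < κ := by positivity
  set q : Config n := WithLp.toLp 2 fun i => κ • act (rot φ) (centered pstar i) with hq_def
  set ξ : Plane := -(κ • act (rot φ) ((n : ℝ)⁻¹ • ∑ j, pstar j)) with hξ
  have hq : ∀ i, q i = κ • act (rot φ) (pstar i) + ξ := fun i => by
    simp only [hq_def, centered, act_sub, hξ]; module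
  have hqsum : ∑ i, q i = 0 := by
    simp only [hq_def]
    rw [← Finset.smul_sum, ← act_sum, sum_centered (by lia)]
    simp [show act (rot φ) 0 = 0 from map_zero (actHom _)]
  have hqS : ‖q‖ = S := by
    rw [← sq_eq_sq₀ (norm_nonneg _) hSpos.le, PiLp.norm_sq_eq_of_L2]
    simp only [hq_def, norm_smul, norm_rot, mul_pow]
    rw [← Finset.mul_sum, ← PiLp.norm_sq_eq_of_L2, Real.norm_of_nonneg hκ.le, hκ_def]
    field_simp
  have hqne : ∀ i j, G.Adj i j → q i ≠ q j := fun i j hij h => by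
    have h1 : κ • act (rot φ) (pstar i - pstar j) = 0 := by
      rw [hq, hq, add_left_inj] at h
      rw [act_sub, smul_sub, h, sub_self]
    rw [← norm_eq_zero, norm_smul, norm_rot, ← norm_smul, norm_eq_zero, smul_eq_zero,
      or_iff_right hκ.ne', sub_eq_zero] at h1
    exact hstar.1 i j hij.ne h1
  obtain ⟨c, hc, hcoer⟩ := exists_bearing_coercive (G := G) hqsum
    (fun v hv => hstar.exists_eq_smul_add_of_similar hrs hκ hq hv)
  -- Each of the two rotated bearings is off by at most `K exp (-ν t)`, hence `2 * K`;
  -- `bearing_drive` contributes `2 * S`.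
  obtain ⟨M, μ, hμ, hlim⟩ := sphere_flow_converges hw hanti (q := q) (S := S)
    (a := 1 / (4 * S ^ 3)) (c := c) (C := 2 * S * (2 * K)) (lam := ν) hSpos (by positivity) hc
    (by positivity) hν hwS hqS (fun t ht => hcoer (w t) (hwsum t ht)) (fun t ht i j => by
      simp only [hF, edgeForce]
      split_ifs with hij
      · have hbw : bearing (p t) i j = bearing (w t) i j := by
          rw [bearing, bearing, hwsub]
        have hshift : ∀ i, |β t i - θ + Real.pi / 2 - φ| ≤ K * Real.exp (-ν * t) := fun i => by
          have h1 : β t i - θ + Real.pi / 2 - φ = β t i - b := by rw [hφ]; ring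
          rw [h1]; exact hb t ht i
        rw [hbw]
        refine (bearing_drive (e := 2 * (K * Real.exp (-ν * t))) ?_ (hqne i j hij) (hwS t ht) hqS
          ?_).trans (le_of_eq (by ring))
        · rw [ne_eq, ← sub_eq_zero, hwsub, sub_eq_zero]
          exact hmeas t ht i j hij
        · rw [bearing_similar hκ hq]
          exact norm_rot_add_rot_sub_le (norm_bearing (hstar.1 i j hij.ne)) (hshift i) (hshift j)
      · rw [inner_zero_right]; simp only [mul_zero, zero_add]; positivity)
  have hfinal : ∀ c : ℝ, c ≠ 0 → (∀ t, 0 ≤ t → ‖w t - c • q‖ ≤ M * Real.exp (-μ * t)) →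
      ∃ q ∈ SignedAngle.similarityClass pstar, ∃ C : ℝ, 0 < C ∧ ∃ lam : ℝ, 0 < lam ∧
      ∀ t : ℝ, 0 ≤ t → ‖p t - q‖ ≤ C * Real.exp (-lam * t) := fun c hc h => by
    refine ⟨WithLp.toLp 2 fun i => c • q i + m, mem_similarityClass (c := c * κ) (φ := φ)
      (ξ := c • ξ + m) (mul_ne_zero hc hκ.ne') (fun i => ?_), |M| + 1, by positivity, μ, hμ,
      fun t ht => ?_⟩
    · simp only [hq]; module
    · have h1 : p t - (WithLp.toLp 2 fun i => c • q i + m) = w t - c • q := by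
        refine PiLp.ext fun i => ?_
        simp only [hw_def, PiLp.sub_apply, PiLp.smul_apply]
        module
      rw [h1]
      refine (h t ht).trans ?_
      gcongr
      linarith [le_abs_self M]
  rcases hlim with h | h
  · exact hfinal 1 one_ne_zero (by simpa using h)
  -- The antipodal limit is the target shape turned by `π`.
  · exact hfinal (-1) (by norm_num) (by simpa using h)
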